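/- Let $S\ge 1$ and let $X(t)$ be a homogeneous continuous-time Markov chain on $\{0,1,\dots,S\}$ with intensity matrix $Q=(q_{ij})$ (nonnegative off-diagonal entries, zero row sums). Put $A=(a_{ij})=Q^{T}$, so $a_{ij}=q_{ji}$. Let $$B=(a_{ij}-a_{i0})_{i,j=1}^S ,$$ let $T$ be the $S\times S$ upper triangular matrix with all entries on and above the diagonal equal to $1$, and set $B^*=TBT^{-1}$. For $D=\mathrm{diag}(d_1,\dots,d_S)$ with all $d_k>0$ put $B^{**}=DB^*D^{-1}$ and let $$h^{**}=\max_{1\le k\le S}\sum_{i} b^{**}_{ik},\qquad h_{**}=\min_{1\le k\le S}\sum_{i} b^{**}_{ik}.$$ Suppose that one of the following holds. (I) (Birth-death chain.) $a_{ij}=0$ if $|i-j|>1$, $a_{i,i+1}=\mu_{i+1}$ and $a_{i+1,i}=\lambda_i$ for $0\le i<S$, and all $\mu_{i+1}$ and $\lambda_i$ are positive. (II) (Batch births, single deaths.) $a_{ij}=0$ if $i<j-1$; $a_{i+k,i}=a_k$ for $k\ge1$, where $a_{k+1}\le a_k$; $a_{i,i+1}=\mu_{i+1}$; all $\mu_{i+1}$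 are positive and $a_2<a_1$. (III) (Batch deaths, single births.) $a_{ij}=0$ if $i>j+1$; $a_{i,i+k}=b_k$ for $k\ge1$, where $b_{k+1}\le b_k$; $a_{i+1,i}=\lambda_i$; all $\lambda_i$ are positive and $b_2<b_1$. (IV) (Batch births and deaths.) $a_{i+k,i}=a_k$ and $a_{i,i+k}=b_k$ for $k\ge1$, where $a_{k+1}\le a_k$ and $b_{k+1}\le b_k$; and $a_2<a_1$, $b_2<b_1$. (Conditions on $a_k,b_k$ concern only $1\le k\le S$; for $S=1$ the conditions $a_2<a_1$ and $b_2<b_1$ are dropped.) Then there are $d_1,\dots,d_S>0$ such that $h^{**}=h_{**}$, that is, all column sums of $B^{**}$ are equal, and such that for every solution $\mathbf y$ of $\mathbf y'(t)=B\mathbf y(t)$ on $[0,\infty)$ for which $\mathbf w(t)=DT\mathbf y(t)$ has $\mathbf w(0)\ge 0$ componentwise, $$\|\mathbf w(t)\|=e^{h_{**}t}\,\|\mathbf w(0)\|\qquad\text{for all } t\ge0,$$ where $\|\mathbf x\|=\sum_i|x_i|$. -/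

import Mathlib

namespace MarkovRate

/-- `Q` is the infinitesimal (intensity) matrix of a homogeneous continuous-time Markov chain with
state space `{0, 1, …, S}`: nonnegative off-diagonal entries and zero row sums. -/
structure IsIntensityMatrix {S : ℕ} (Q : Matrix (Fin (S + 1)) (Fin (S + 1)) ℝ) : Prop where
  offDiag_nonneg : ∀ i j, i ≠ j → 0 ≤ Q i j
  row_sum : ∀ i, ∑ j, Q i j = 0

/-- Class (I), birth-death chains, in terms of the transposed intensity matrix `A`:
`a_{ij} = 0` if `|i - j| > 1`, `a_{i,i+1} = μ_{i+1}` and `a_{i+1,i} = λ_i`. -/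
structure IsClassI {S : ℕ} (A : Matrix (Fin (S + 1)) (Fin (S + 1)) ℝ)
    (lam mu : ℕ → ℝ) : Prop where
  zero : ∀ i j : Fin (S + 1), 1 < |((i : ℕ) : ℤ) - ((j : ℕ) : ℤ)| → A i j = 0
  death : ∀ i : Fin S, A i.castSucc i.succ = mu ((i : ℕ) + 1)
  birth : ∀ i : Fin S, A i.succ i.castSucc = lam (i : ℕ)

/-- Class (II), batch births and single deaths: `a_{ij} = 0` if `i < j - 1`,
`a_{i+k,i} = a_k` for `k ≥ 1`, `a_{i,i+1} = μ_{i+1}`, and `a_{k+1} ≤ a_k`.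
Only `a_1, …, a_S` are rates of the chain, so only these are constrained. -/
structure IsClassII {S : ℕ} (A : Matrix (Fin (S + 1)) (Fin (S + 1)) ℝ)
    (a mu : ℕ → ℝ) : Prop where
  zero : ∀ i j : Fin (S + 1), (i : ℕ) + 1 < (j : ℕ) → A i j = 0
  birth : ∀ (i j : Fin (S + 1)) (k : ℕ), 1 ≤ k → (j : ℕ) = (i : ℕ) + k → A j i = a k
  death : ∀ i : Fin S, A i.castSucc i.succ = mu ((i : ℕ) + 1)
  mono : ∀ k : ℕ, 1 ≤ k → k + 1 ≤ S → a (k + 1) ≤ a k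

/-- Class (III), batch deaths and single births: `a_{ij} = 0` if `i > j + 1`,
`a_{i,i+k} = b_k` for `k ≥ 1`, `a_{i+1,i} = λ_i`, and `b_{k+1} ≤ b_k`. -/
structure IsClassIII {S : ℕ} (A : Matrix (Fin (S + 1)) (Fin (S + 1)) ℝ)
    (lam b : ℕ → ℝ) : Prop where
  zero : ∀ i j : Fin (S + 1), (j : ℕ) + 1 < (i : ℕ) → A i j = 0
  death : ∀ (i j : Fin (S + 1)) (k : ℕ), 1 ≤ k → (j : ℕ) = (i : ℕ) + k → A i j = b k
  birth : ∀ i : Fin S, A i.succ i.castSucc = lam (i : ℕ)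
  mono : ∀ k : ℕ, 1 ≤ k → k + 1 ≤ S → b (k + 1) ≤ b k

/-- Class (IV), batch births and batch deaths: `a_{i+k,i} = a_k` and `a_{i,i+k} = b_k` for
`k ≥ 1`, with `a_{k+1} ≤ a_k` and `b_{k+1} ≤ b_k`. -/
structure IsClassIV {S : ℕ} (A : Matrix (Fin (S + 1)) (Fin (S + 1)) ℝ)
    (a b : ℕ → ℝ) : Prop where
  birth : ∀ (i j : Fin (S + 1)) (k : ℕ), 1 ≤ k → (j : ℕ) = (i : ℕ) + k → A j i = a k
  death : ∀ (i j : Fin (S + 1)) (k : ℕ), 1 ≤ k → (j : ℕ) = (i : ℕ) + k → A i j = b k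
  mono_birth : ∀ k : ℕ, 1 ≤ k → k + 1 ≤ S → a (k + 1) ≤ a k
  mono_death : ∀ k : ℕ, 1 ≤ k → k + 1 ≤ S → b (k + 1) ≤ b k

/-- The reduced matrix `B = (a_{ij} - a_{i0})`, `1 ≤ i, j ≤ S`, with `A` the transpose of `Q`.
The index `i : Fin S` stands for the state `i + 1`. -/
def reduced {S : ℕ} (Q : Matrix (Fin (S + 1)) (Fin (S + 1)) ℝ) : Matrix (Fin S) (Fin S) ℝ :=
  Matrix.of fun i j => Q.transpose i.succ j.succ - Q.transpose i.succ 0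

/-- The upper triangular matrix `T` all of whose entries on and above the diagonal are `1`. -/
def upperOnes (S : ℕ) : Matrix (Fin S) (Fin S) ℝ :=
  Matrix.of fun i j => if i ≤ j then 1 else 0

/-- `B* = T B T⁻¹`. -/
noncomputable def bStar {S : ℕ} (Q : Matrix (Fin (S + 1)) (Fin (S + 1)) ℝ) :
    Matrix (Fin S) (Fin S) ℝ :=
  upperOnes S * reduced Q * (upperOnes S)⁻¹

/-- `B** = D B* D⁻¹` with `D = diag (d_1, …, d_S)`. -/
noncomputable def bStarStar {S : ℕ} (Q : Matrix (Fin (S + 1)) (Fin (S + 1)) ℝ)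
    (d : Fin S → ℝ) : Matrix (Fin S) (Fin S) ℝ :=
  Matrix.diagonal d * bStar Q * (Matrix.diagonal d)⁻¹

/-- `h^{**}`, the largest column sum of `B**`. -/
noncomputable def hUpper {S : ℕ} [NeZero S] (Q : Matrix (Fin (S + 1)) (Fin (S + 1)) ℝ)
    (d : Fin S → ℝ) : ℝ :=
  Finset.univ.sup' Finset.univ_nonempty fun k => ∑ i, bStarStar Q d i k

/-- `h_{**}`, the smallest column sum of `B**`. -/
noncomputable def hLower {S : ℕ} [NeZero S] (Q : Matrix (Fin (S + 1)) (Fin (S + 1)) ℝ)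
    (d : Fin S → ℝ) : ℝ :=
  Finset.univ.inf' Finset.univ_nonempty fun k => ∑ i, bStarStar Q d i k

/-- `y` solves the homogeneous reduced system `dy/dt = B y` on `[0, ∞)`. -/
def IsReducedSolution {S : ℕ} (Q : Matrix (Fin (S + 1)) (Fin (S + 1)) ℝ)
    (y : ℝ → Fin S → ℝ) : Prop :=
  ∀ t : ℝ, 0 ≤ t → HasDerivWithinAt y ((reduced Q).mulVec (y t)) (Set.Ici 0) t

/-- The transformed vector `w = D T y`. -/
def weighted {S : ℕ} (d : Fin S → ℝ) (y : Fin S → ℝ) : Fin S → ℝ :=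
  (Matrix.diagonal d * upperOnes S).mulVec y

/-- The `l_1`-norm. -/
def l1Norm {S : ℕ} (x : Fin S → ℝ) : ℝ := ∑ i, |x i|

end MarkovRate

/-! The cumulative vector `z = T y` satisfies `z' = B* z`. The entry of `B*` at `(j, k)` is the
total rate from state `k + 1` into the states above `j`, minus the same total from state `k`
(`bStar_apply`), diagonal entries of `A` included. In each class this makes `B*` nonnegative off the
diagonal and positive next to it.

Hence a shift of `B*` is nonnegative with a positive power, and Perron's theorem yields a positive
row vector `d` with `d B* = h d` (`exists_pos_left_eigenvector`). Used as weights, `d` makes every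
column sum of `B**` equal to `h`. The flow of `B*` preserves the nonnegative cone
(`nonneg_of_metzler`), so `‖w‖` is the linear functional `d ⬝ᵥ z`, which solves `f' = h f`. -/

open Set

namespace MarkovRate

/-! ### Perron's theorem via the Collatz–Wielandt maximum -/

section Perron

variable {n : Type*} [Fintype n]

/-- Entrywise nonnegative matrices preserve the nonnegative cone. -/
theorem mulVec_nonneg_of_nonneg {N : Matrix n n ℝ} (hN : ∀ i j, 0 ≤ N i j) {x : n → ℝ}
    (hx : ∀ i, 0 ≤ x i) (i : n) : 0 ≤ N.mulVec x i :=
  Finset.sum_nonneg fun j _ => mul_nonneg (hN i j) (hx j)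

/-- Entrywise positive matrices map nonzero nonnegative vectors to positive vectors. -/
theorem mulVec_pos_of_pos {P : Matrix n n ℝ} (hP : ∀ i j, 0 < P i j) {x : n → ℝ}
    (hx : ∀ i, 0 ≤ x i) {j : n} (hj : x j ≠ 0) (i : n) : 0 < P.mulVec x i :=
  Finset.sum_pos' (fun k _ => mul_nonneg (hP i k).le (hx k))
    ⟨j, Finset.mem_univ j, mul_pos (hP i j) (lt_of_le_of_ne (hx j) (Ne.symm hj))⟩

/-- The Collatz–Wielandt problem for a nonnegative matrix has a maximizer. -/
theorem exists_collatzWielandt_max [Nonempty n] {N : Matrix n n ℝ} (hN : ∀ i j, 0 ≤ N i j) :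
    ∃ x ∈ stdSimplex ℝ n, ∃ r : ℝ, (∀ i, r * x i ≤ N.mulVec x i) ∧
      ∀ z ∈ stdSimplex ℝ n, ∀ s : ℝ, (∀ i, s * z i ≤ N.mulVec z i) → s ≤ r := by
  classical
  have bound : ∀ z ∈ stdSimplex ℝ n, ∀ s : ℝ, (∀ i, s * z i ≤ N.mulVec z i) →
      s ≤ ∑ i, ∑ j, N i j := by
    intro z hz s hs
    calc s = ∑ i, s * z i := by rw [← Finset.mul_sum, hz.2, mul_one]
      _ ≤ ∑ i, N.mulVec z i := Finset.sum_le_sum fun i _ => hs i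
      _ ≤ ∑ i, ∑ j, N i j := Finset.sum_le_sum fun i _ => Finset.sum_le_sum fun j _ =>
          mul_le_of_le_one_right (hN i j)
            (hz.2 ▸ Finset.single_le_sum (fun k _ => hz.1 k) (Finset.mem_univ j))
  set R := ∑ i, ∑ j, N i j
  have hR : 0 ≤ R := Finset.sum_nonneg fun i _ => Finset.sum_nonneg fun j _ => hN i j
  -- By `bound`, cutting at `R` loses no admissible value; cutting at `0` is harmless because `0` is
  -- always admissible.
  let K : Set ((n → ℝ) × ℝ) :=
    (stdSimplex ℝ n ×ˢ Icc 0 R) ∩ {p | ∀ i, p.2 * p.1 i ≤ N.mulVec p.1 i}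
  have hclosed : IsClosed {p : (n → ℝ) × ℝ | ∀ i, p.2 * p.1 i ≤ N.mulVec p.1 i} := by
    simp only [ofPred_forall]
    refine isClosed_iInter fun i => isClosed_le (by fun_prop) ?_
    simp only [Matrix.mulVec, dotProduct]
    fun_prop
  have hK : IsCompact K := ((isCompact_stdSimplex ℝ n).prod isCompact_Icc).inter_right hclosed
  have hne : K.Nonempty := by
    obtain ⟨i₀⟩ := ‹Nonempty n›
    refine ⟨(Pi.single i₀ 1, 0), ⟨single_mem_stdSimplex ℝ i₀, le_refl _, hR⟩, fun i => ?_⟩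
    simpa using hN i i₀
  obtain ⟨⟨x, r⟩, ⟨⟨hx, hr⟩, hxr⟩, hmax⟩ := hK.exists_isMaxOn hne continuous_snd.continuousOn
  refine ⟨x, hx, r, hxr, fun z hz s hs => ?_⟩
  rcases le_total s 0 with h | h
  · exact h.trans hr.1
  · exact hmax (show (z, s) ∈ K from ⟨⟨hz, h, bound z hz s hs⟩, hs⟩)

/-- Perron's theorem: a nonnegative matrix with a positive power has a positive eigenvector. -/
theorem exists_pos_eigenvector [DecidableEq n] [Nonempty n] {N : Matrix n n ℝ}
    (hN : ∀ i j, 0 ≤ N i j) {k : ℕ} (hk : ∀ i j, 0 < (N ^ k) i j) :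
    ∃ (r : ℝ) (x : n → ℝ), (∀ i, 0 < x i) ∧ N.mulVec x = r • x := by
  obtain ⟨x, hx, r, hxr, hmax⟩ := exists_collatzWielandt_max hN
  obtain ⟨j, hj⟩ : ∃ j, x j ≠ 0 := by
    by_contra! h
    simpa [h] using hx.2
  set z := (N ^ k).mulVec x with hz
  have hzpos : ∀ i, 0 < z i := mulVec_pos_of_pos hk hx.1 hj
  have heig : N.mulVec x = r • x := by
    by_contra hne
    have hy : ∀ i, 0 ≤ (N.mulVec x - r • x) i := fun i => by
      simpa using hxr i
    obtain ⟨l, hl⟩ : ∃ l, (N.mulVec x - r • x) l ≠ 0 := by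
      by_contra! h
      exact hne (sub_eq_zero.1 (funext h))
    -- `N ^ k` commutes with `N` and turns the nonzero defect of `x` into a strictly positive defect
    -- of `z`. The least ratio `ε` then makes `r + ε` admissible for the normalized `z`,
    -- contradicting maximality.
    have hgap : ∀ i, 0 < N.mulVec z i - r * z i := fun i => by
      have := mulVec_pos_of_pos hk hy hl i
      rw [Matrix.mulVec_sub, Matrix.mulVec_smul, Matrix.mulVec_mulVec, ← pow_succ, pow_succ',
        ← Matrix.mulVec_mulVec, ← hz] at this
      exact this
    obtain ⟨m, hm⟩ := Finite.exists_min fun i => (N.mulVec z i - r * z i) / z i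
    set ε := (N.mulVec z m - r * z m) / z m
    have hε : 0 < ε := div_pos (hgap m) (hzpos m)
    have hsum : 0 < ∑ i, z i := Finset.sum_pos (fun i _ => hzpos i) Finset.univ_nonempty
    have hle := hmax ((∑ i, z i)⁻¹ • z)
      ⟨fun i => mul_nonneg (inv_pos.2 hsum).le (hzpos i).le, by
        simp [← Finset.mul_sum, inv_mul_cancel₀ hsum.ne']⟩ (r + ε) fun i => by
        have h := (le_div_iff₀ (hzpos i)).1 (hm i)
        rw [Matrix.mulVec_smul, Pi.smul_apply, Pi.smul_apply, smul_eq_mul, smul_eq_mul,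
          mul_left_comm]
        exact mul_le_mul_of_nonneg_left (by linarith) (inv_pos.2 hsum).le
    linarith
  have hpow : ∀ m : ℕ, (N ^ m).mulVec x = r ^ m • x := fun m => by
    induction m with
    | zero => simp
    | succ m ih =>
      rw [pow_succ, ← Matrix.mulVec_mulVec, heig, Matrix.mulVec_smul, ih, smul_smul, pow_succ']
  -- A zero coordinate of `x` would also vanish in `N ^ k x = r ^ k x`, which is positive.
  refine ⟨r, x, fun i => lt_of_le_of_ne (hx.1 i) fun h => ?_, heig⟩
  have := hzpos i
  rw [hz, hpow, Pi.smul_apply, ← h, smul_zero] at this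
  exact this.false

end Perron

/-! ### Perron vectors of Metzler matrices -/

/-- Powers of a nonnegative matrix with positive tridiagonal part fill up the band. -/
theorem pow_pos_of_tridiagonal_pos {S : ℕ} {N : Matrix (Fin S) (Fin S) ℝ}
    (hN : ∀ i j, 0 ≤ N i j)
    (htri : ∀ i j : Fin S, (i : ℕ) ≤ j + 1 → (j : ℕ) ≤ i + 1 → 0 < N i j) (m : ℕ) :
    (∀ i j, 0 ≤ (N ^ m) i j) ∧
      ∀ i j : Fin S, (i : ℕ) ≤ j + m → (j : ℕ) ≤ i + m → 0 < (N ^ m) i j := by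
  induction m with
  | zero =>
    refine ⟨fun i j => ?_, fun i j h₁ h₂ => ?_⟩
    · rw [pow_zero, Matrix.one_apply]
      split_ifs <;> norm_num
    · obtain rfl : i = j := Fin.ext (by omega)
      simp
  | succ m ih =>
    refine ⟨fun i j => ?_, fun i j h₁ h₂ => ?_⟩
    · rw [pow_succ', Matrix.mul_apply]
      exact Finset.sum_nonneg fun l _ => mul_nonneg (hN i l) (ih.1 l j)
    -- `l` is one step from `i` towards `j`.
    · obtain ⟨l, hl₁, hl₂, hl₃, hl₄⟩ : ∃ l : Fin S, (i : ℕ) ≤ l + 1 ∧ (l : ℕ) ≤ i + 1 ∧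
          (l : ℕ) ≤ j + m ∧ (j : ℕ) ≤ l + m := by
        rcases lt_trichotomy (i : ℕ) j with h | h | h
        · exact ⟨⟨i + 1, by omega⟩, by simp; omega, by simp, by simp; omega, by simp; omega⟩
        · exact ⟨i, by omega, by omega, by omega, by omega⟩
        · exact ⟨⟨i - 1, by omega⟩, by simp; omega, by simp; omega, by simp; omega,
            by simp; omega⟩
      rw [pow_succ', Matrix.mul_apply]
      exact Finset.sum_pos' (fun l _ => mul_nonneg (hN i l) (ih.1 l j))
        ⟨l, Finset.mem_univ l, mul_pos (htri i l hl₁ hl₂) (ih.2 l j hl₃ hl₄)⟩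

/-- A Metzler matrix becomes nonnegative with positive diagonal after adding a multiple of `1`. -/
theorem exists_shift_pos {n : Type*} [Fintype n] (M : Matrix n n ℝ) :
    ∃ c : ℝ, ∀ i, 0 < M i i + c := by
  refine ⟨1 + ∑ i, |M i i|, fun i => ?_⟩
  have h₁ : |M i i| ≤ ∑ i, |M i i| :=
    Finset.single_le_sum (f := fun i => |M i i|) (fun j _ => abs_nonneg _) (Finset.mem_univ i)
  have h₂ := neg_abs_le (M i i)
  linarith

/-- A Metzler matrix with positive sub- and superdiagonal has a positive left eigenvector. -/
theorem exists_pos_left_eigenvector {S : ℕ} [NeZero S] {M : Matrix (Fin S) (Fin S) ℝ}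
    (hM : ∀ i j, i ≠ j → 0 ≤ M i j)
    (hlow : ∀ i j : Fin S, (i : ℕ) = j + 1 → 0 < M i j)
    (hup : ∀ i j : Fin S, (j : ℕ) = i + 1 → 0 < M i j) :
    ∃ (h : ℝ) (d : Fin S → ℝ), (∀ i, 0 < d i) ∧ Matrix.vecMul d M = h • d := by
  obtain ⟨c, hc⟩ := exists_shift_pos M
  set N : Matrix (Fin S) (Fin S) ℝ := (M + c • 1).transpose with hNdef
  have hdiag : ∀ i, N i i = M i i + c := fun i => by simp [hNdef]
  have hoff : ∀ i j, i ≠ j → N i j = M j i := fun i j hij => by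
    simp [hNdef, Matrix.one_apply_ne, hij]
  have hN : ∀ i j, 0 ≤ N i j := fun i j => by
    by_cases hij : i = j
    · subst hij
      exact hdiag i ▸ (hc i).le
    · exact hoff i j hij ▸ hM j i (Ne.symm hij)
  have htri : ∀ i j : Fin S, (i : ℕ) ≤ j + 1 → (j : ℕ) ≤ i + 1 → 0 < N i j := by
    intro i j h₁ h₂
    by_cases hij : i = j
    · subst hij
      exact hdiag i ▸ hc i
    · have : (i : ℕ) ≠ j := fun h => hij (Fin.ext h)
      rw [hoff i j hij]
      rcases lt_or_gt_of_ne this with h | h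
      · exact hlow j i (by omega)
      · exact hup j i (by omega)
  obtain ⟨r, d, hd, hr⟩ := exists_pos_eigenvector hN (k := S) fun i j =>
    (pow_pos_of_tridiagonal_pos hN htri S).2 i j (by omega) (by omega)
  refine ⟨r - c, d, hd, ?_⟩
  rw [hNdef, Matrix.mulVec_transpose, Matrix.vecMul_add, Matrix.vecMul_smul,
    Matrix.vecMul_one] at hr
  rw [sub_smul, ← hr, add_sub_cancel_right]

/-! ### Linear flows and the nonnegative cone -/

section Flow

variable {n : Type*} [Fintype n]

/-- The exponential of a cone-preserving operator preserves the nonnegative cone. -/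
theorem exp_apply_nonneg {L : (n → ℝ) →L[ℝ] (n → ℝ)}
    (hL : ∀ x : n → ℝ, 0 ≤ x → 0 ≤ L x) {x : n → ℝ} (hx : 0 ≤ x) :
    0 ≤ NormedSpace.exp L x := by
  have hpow : ∀ m : ℕ, 0 ≤ (L ^ m) x := fun m => by
    induction m with
    | zero => simpa using hx
    | succ m ih =>
      rw [pow_succ']
      exact hL _ ih
  have hs := (NormedSpace.exp_series_hasSum_exp' (𝕂 := ℝ) L).mapL
    (ContinuousLinearMap.apply ℝ (n → ℝ) x)
  intro i
  refine HasSum.nonneg (fun m => ?_) (Pi.hasSum.1 hs i)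
  rw [ContinuousLinearMap.apply_apply, _root_.smul_apply, Pi.smul_apply]
  exact smul_nonneg (inv_nonneg.2 (Nat.cast_nonneg _)) (hpow m i)

/-- Solutions of a linear system on `[0, ∞)` are given by the exponential. -/
theorem eq_exp_apply_of_hasDerivWithinAt {L : (n → ℝ) →L[ℝ] (n → ℝ)} {v : ℝ → n → ℝ}
    (hv : ∀ t, 0 ≤ t → HasDerivWithinAt v (L (v t)) (Ici 0) t) {t : ℝ} (ht : 0 ≤ t) :
    v t = NormedSpace.exp (t • L) (v 0) := by
  -- This function of `s` is constant; its values at `0` and `t` are the two sides.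
  have hderiv : ∀ s, 0 ≤ s → HasDerivWithinAt
      (fun s => NormedSpace.exp ((t - s) • L) (v s)) 0 (Ici 0) s := by
    intro s hs
    have h₁ := (hasDerivAt_exp_smul_const (𝕂 := ℝ) L (t - s)).scomp s
      ((hasDerivAt_id s).const_sub t)
    have h₂ := h₁.hasDerivWithinAt (s := Ici 0) |>.clm_apply (hv s hs)
    exact h₂.congr_deriv (by simp)
  have hconst := constant_of_has_deriv_right_zero (a := 0) (b := t)
    (fun s hs => ((hderiv s hs.1).mono Icc_subset_Ici_self).continuousWithinAt)
    (fun s hs => (hderiv s hs.1).mono (Ici_subset_Ici.2 hs.1)) t (right_mem_Icc.2 ht)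
  simpa using hconst

/-- The flow of a Metzler matrix preserves the nonnegative cone. -/
theorem nonneg_of_metzler [DecidableEq n] {M : Matrix n n ℝ} (hM : ∀ i j, i ≠ j → 0 ≤ M i j)
    {z : ℝ → n → ℝ} (hz : ∀ t, 0 ≤ t → HasDerivWithinAt z (M.mulVec (z t)) (Ici 0) t)
    (h0 : 0 ≤ z 0) {t : ℝ} (ht : 0 ≤ t) : 0 ≤ z t := by
  obtain ⟨c, hc⟩ := exists_shift_pos M
  set N : Matrix n n ℝ := M + c • 1 with hNdef
  have hN : ∀ i j, 0 ≤ N i j := fun i j => by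
    by_cases hij : i = j
    · subst hij
      simpa [hNdef] using (hc i).le
    · simpa [hNdef, Matrix.one_apply, hij] using hM i j hij
  let L : (n → ℝ) →L[ℝ] (n → ℝ) := LinearMap.toContinuousLinearMap N.mulVecLin
  have hL : ∀ x, L x = N.mulVec x := fun x => rfl
  -- The factor `exp (c * s)` replaces `M` by the nonnegative matrix `N` without changing signs.
  have hv : ∀ s, 0 ≤ s → HasDerivWithinAt (fun s => Real.exp (c * s) • z s)
      (L (Real.exp (c * s) • z s)) (Ici 0) s := by
    intro s hs
    have h₁ : HasDerivAt (fun s => Real.exp (c * s)) (Real.exp (c * s) * c) s := by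
      simpa using ((hasDerivAt_id s).const_mul c).exp
    refine (h₁.hasDerivWithinAt.smul (hz s hs)).congr_deriv ?_
    rw [hL, hNdef, Matrix.mulVec_smul, Matrix.add_mulVec, Matrix.smul_mulVec, Matrix.one_mulVec,
      smul_add, smul_smul]
  have hpos : 0 ≤ Real.exp (c * t) • z t := by
    rw [eq_exp_apply_of_hasDerivWithinAt hv ht]
    refine exp_apply_nonneg (fun x hx => ?_) (by simpa using h0)
    exact smul_nonneg ht fun i => mulVec_nonneg_of_nonneg hN hx i
  intro i
  exact nonneg_of_mul_nonneg_right (hpos i) (Real.exp_pos _)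

end Flow

/-- Solutions of the scalar equation `f' = h f` on `[0, ∞)`. -/
theorem eq_exp_mul_of_hasDerivWithinAt {f : ℝ → ℝ} {h : ℝ}
    (hf : ∀ t, 0 ≤ t → HasDerivWithinAt f (h * f t) (Ici 0) t) {t : ℝ} (ht : 0 ≤ t) :
    f t = Real.exp (h * t) * f 0 := by
  have hderiv : ∀ s, 0 ≤ s →
      HasDerivWithinAt (fun s => Real.exp (h * (t - s)) * f s) 0 (Ici 0) s := by
    intro s hs
    have h₁ : HasDerivAt (fun s => Real.exp (h * (t - s))) (Real.exp (h * (t - s)) * (h * -1)) s :=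
      (((hasDerivAt_id s).const_sub t).const_mul h).exp
    exact (h₁.hasDerivWithinAt.mul (hf s hs)).congr_deriv (by ring)
  have hconst := constant_of_has_deriv_right_zero (a := 0) (b := t)
    (fun s hs => ((hderiv s hs.1).mono Icc_subset_Ici_self).continuousWithinAt)
    (fun s hs => (hderiv s hs.1).mono (Ici_subset_Ici.2 hs.1)) t (right_mem_Icc.2 ht)
  simpa using hconst

/-! ### Entries of `B*` -/

/-- Telescoping sum over an initial segment of `Fin S`. -/
theorem sum_ite_le_succ_sub_castSucc {S : ℕ} (f : Fin (S + 1) → ℝ) (j : Fin S) :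
    ∑ k : Fin S, (f k.succ - f k.castSucc) * (if k ≤ j then 1 else 0) = f j.succ - f 0 := by
  induction S with
  | zero => exact j.elim0
  | succ S ih =>
    rw [Fin.sum_univ_succ]
    refine Fin.cases ?_ (fun j => ?_) j
    · simp [Fin.succ_ne_zero]
    · have := ih (fun k => f k.succ) j
      simp only [Fin.succ_le_succ_iff, Fin.zero_le, if_true, mul_one, Fin.castSucc_zero,
        ← Fin.succ_castSucc]
      rw [this]
      simp

variable {S : ℕ}

theorem isUnit_det_upperOnes (S : ℕ) : IsUnit (upperOnes S).det := by
  have h : (upperOnes S).BlockTriangular id := fun i j hij => by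
    simp only [upperOnes, Matrix.of_apply]
    exact if_neg (not_le.2 hij)
  rw [Matrix.det_of_isUpperTriangular h]
  simp [upperOnes]

theorem bStar_mul_upperOnes (Q : Matrix (Fin (S + 1)) (Fin (S + 1)) ℝ) :
    bStar Q * upperOnes S = upperOnes S * reduced Q :=
  Matrix.nonsing_inv_mul_cancel_right _ _ (isUnit_det_upperOnes S)

theorem bStar_apply (Q : Matrix (Fin (S + 1)) (Fin (S + 1)) ℝ) (j k : Fin S) :
    bStar Q j k = ∑ i : Fin S, if j ≤ i then
      Q.transpose i.succ k.succ - Q.transpose i.succ k.castSucc else 0 := by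
  -- Telescoping factors `B` as `C T`, with `C` the differences of adjacent columns of `A`, so `B* =
  -- T C`.
  have hred : reduced Q = (Matrix.of fun i k : Fin S =>
      Q.transpose i.succ k.succ - Q.transpose i.succ k.castSucc) * upperOnes S := by
    ext i l
    rw [Matrix.mul_apply]
    exact (sum_ite_le_succ_sub_castSucc (fun m => Q.transpose i.succ m) l).symm
  rw [bStar, hred, ← Matrix.mul_assoc,
    Matrix.mul_nonsing_inv_cancel_right _ _ (isUnit_det_upperOnes S), Matrix.mul_apply]
  simp [upperOnes]

/-- The entries of `B*` in terms of the lower states, obtained from the vanishing column sums. -/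
theorem bStar_apply_eq_sum_lower {Q : Matrix (Fin (S + 1)) (Fin (S + 1)) ℝ}
    (hQ : IsIntensityMatrix Q) (j k : Fin S) :
    bStar Q j k = ∑ m : Fin (S + 1), if m ≤ j.castSucc then
      Q.transpose m k.castSucc - Q.transpose m k.succ else 0 := by
  have hcol : ∀ l, ∑ m, Q.transpose m l = 0 := hQ.row_sum
  have hzero : ∑ m, (Q.transpose m k.succ - Q.transpose m k.castSucc) = 0 := by
    rw [Finset.sum_sub_distrib, hcol, hcol, sub_zero]
  have hsplit : ∑ m : Fin (S + 1), (if m ≤ j.castSucc then 0 else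
      Q.transpose m k.succ - Q.transpose m k.castSucc) = bStar Q j k := by
    rw [bStar_apply, Fin.sum_univ_succ, if_pos (Fin.zero_le _), zero_add]
    refine Finset.sum_congr rfl fun i _ => ?_
    by_cases h : j ≤ i
    · rw [if_pos h, if_neg]
      rw [not_le, Fin.castSucc_lt_succ_iff]
      exact h
    · rw [if_neg h, if_pos]
      rw [← not_lt, Fin.castSucc_lt_succ_iff]
      exact h
  rw [← hsplit, ← sub_eq_zero, ← Finset.sum_sub_distrib]
  refine Eq.trans ?_ hzero
  refine Finset.sum_congr rfl fun m _ => ?_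
  split_ifs <;> ring

/-! ### Monotone rates and the signs of `B*` -/

/-- Above state `k`, jumps to a state are at least as frequent from `k + 1` as from `k`,
strictly so for the nearest one. -/
def UpwardMonotone (A : Matrix (Fin (S + 1)) (Fin (S + 1)) ℝ) : Prop :=
  ∀ i k : Fin S, k < i → A i.succ k.castSucc ≤ A i.succ k.succ ∧
    ((i : ℕ) = k + 1 → A i.succ k.castSucc < A i.succ k.succ)

/-- Below state `k`, jumps to a state are at least as frequent from `k` as from `k + 1`,
strictly so for the nearest one. -/
def DownwardMonotone (A : Matrix (Fin (S + 1)) (Fin (S + 1)) ℝ) : Prop :=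
  ∀ (m : Fin (S + 1)) (k : Fin S), m < k.castSucc → A m k.succ ≤ A m k.castSucc ∧
    ((k : ℕ) = m + 1 → A m k.succ < A m k.castSucc)

theorem UpwardMonotone.bStar_nonneg {Q : Matrix (Fin (S + 1)) (Fin (S + 1)) ℝ}
    (h : UpwardMonotone Q.transpose) {j k : Fin S} (hkj : k < j) :
    0 ≤ bStar Q j k ∧ ((j : ℕ) = k + 1 → 0 < bStar Q j k) := by
  have hterm : ∀ i : Fin S, 0 ≤ if j ≤ i then
      Q.transpose i.succ k.succ - Q.transpose i.succ k.castSucc else 0 := fun i => by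
    split_ifs with hi
    · exact sub_nonneg.2 (h i k (hkj.trans_le hi)).1
    · exact le_rfl
  rw [bStar_apply]
  refine ⟨Finset.sum_nonneg fun i _ => hterm i, fun hj => ?_⟩
  refine Finset.sum_pos' (fun i _ => hterm i) ⟨j, Finset.mem_univ j, ?_⟩
  rw [if_pos le_rfl]
  exact sub_pos.2 ((h j k hkj).2 hj)

/-- For `j < k` the sum over upper states meets the diagonal of `A`; the complementary sum over
lower states avoids it. -/
theorem DownwardMonotone.bStar_nonneg {Q : Matrix (Fin (S + 1)) (Fin (S + 1)) ℝ}
    (h : DownwardMonotone Q.transpose) (hQ : IsIntensityMatrix Q) {j k : Fin S} (hjk : j < k) :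
    0 ≤ bStar Q j k ∧ ((k : ℕ) = j + 1 → 0 < bStar Q j k) := by
  have hjk' : j.castSucc < k.castSucc := hjk
  have hterm : ∀ m : Fin (S + 1), 0 ≤ if m ≤ j.castSucc then
      Q.transpose m k.castSucc - Q.transpose m k.succ else 0 := fun m => by
    split_ifs with hm
    · exact sub_nonneg.2 (h m k (hm.trans_lt hjk')).1
    · exact le_rfl
  rw [bStar_apply_eq_sum_lower hQ]
  refine ⟨Finset.sum_nonneg fun m _ => hterm m, fun hk => ?_⟩
  refine Finset.sum_pos' (fun m _ => hterm m) ⟨j.castSucc, Finset.mem_univ _, ?_⟩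
  rw [if_pos le_rfl]
  exact sub_pos.2 ((h j.castSucc k hjk').2 hk)

theorem upwardMonotone_of_single {Q : Matrix (Fin (S + 1)) (Fin (S + 1)) ℝ}
    (hQ : IsIntensityMatrix Q) {lam : ℕ → ℝ}
    (hzero : ∀ i j : Fin (S + 1), (j : ℕ) + 1 < (i : ℕ) → Q.transpose i j = 0)
    (hbirth : ∀ i : Fin S, Q.transpose i.succ i.castSucc = lam (i : ℕ))
    (hlam : ∀ i < S, 0 < lam i) : UpwardMonotone Q.transpose := by
  intro i k hki
  have hki' : (k : ℕ) < i := hki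
  rw [hzero i.succ k.castSucc (by simp; omega)]
  refine ⟨hQ.offDiag_nonneg _ _ fun h => hki.ne (Fin.succ_injective _ h), fun hi => ?_⟩
  have : k.succ = i.castSucc := Fin.ext (by simp; omega)
  rw [this, hbirth]
  exact hlam i i.2

theorem downwardMonotone_of_single {Q : Matrix (Fin (S + 1)) (Fin (S + 1)) ℝ}
    (hQ : IsIntensityMatrix Q) {mu : ℕ → ℝ}
    (hzero : ∀ i j : Fin (S + 1), (i : ℕ) + 1 < (j : ℕ) → Q.transpose i j = 0)
    (hdeath : ∀ i : Fin S, Q.transpose i.castSucc i.succ = mu ((i : ℕ) + 1))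
    (hmu : ∀ i < S, 0 < mu (i + 1)) : DownwardMonotone Q.transpose := by
  intro m k hmk
  have hmk' : (m : ℕ) < k := hmk
  rw [hzero m k.succ (by simp; omega)]
  refine ⟨hQ.offDiag_nonneg _ _ hmk.ne', fun hk => ?_⟩
  have h₁ : m = (⟨m, by omega⟩ : Fin S).castSucc := rfl
  have h₂ : k.castSucc = (⟨m, by omega⟩ : Fin S).succ := Fin.ext (by simp; omega)
  rw [h₁, h₂, hdeath]
  exact hmu m (by omega)

/-- From `k + 1` the jump is one shorter than from `k`; the nearest target compares `a 1` with `a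
2`. For `S = 1` there is no such target. -/
theorem upwardMonotone_of_batch {A : Matrix (Fin (S + 1)) (Fin (S + 1)) ℝ} {a : ℕ → ℝ}
    (hbirth : ∀ (i j : Fin (S + 1)) (k : ℕ), 1 ≤ k → (j : ℕ) = (i : ℕ) + k → A j i = a k)
    (hmono : ∀ k : ℕ, 1 ≤ k → k + 1 ≤ S → a (k + 1) ≤ a k)
    (ha : 2 ≤ S → a 2 < a 1) : UpwardMonotone A := by
  intro i k hki
  have hki' : (k : ℕ) < i := hki
  rw [hbirth k.castSucc i.succ (i - k + 1) (by omega) (by simp; omega),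
    hbirth k.succ i.succ (i - k) (by omega) (by simp; omega)]
  refine ⟨hmono _ (by omega) (by omega), fun hi => ?_⟩
  rw [hi, Nat.add_sub_cancel_left]
  exact ha (by omega)

theorem downwardMonotone_of_batch {A : Matrix (Fin (S + 1)) (Fin (S + 1)) ℝ} {b : ℕ → ℝ}
    (hdeath : ∀ (i j : Fin (S + 1)) (k : ℕ), 1 ≤ k → (j : ℕ) = (i : ℕ) + k → A i j = b k)
    (hmono : ∀ k : ℕ, 1 ≤ k → k + 1 ≤ S → b (k + 1) ≤ b k)
    (hb : 2 ≤ S → b 2 < b 1) : DownwardMonotone A := by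
  intro m k hmk
  have hmk' : (m : ℕ) < k := hmk
  rw [hdeath m k.succ (k - m + 1) (by omega) (by simp; omega),
    hdeath m k.castSucc (k - m) (by omega) (by simp; omega)]
  refine ⟨hmono _ (by omega) (by omega), fun hk => ?_⟩
  rw [hk, Nat.add_sub_cancel_left]
  exact hb (by omega)

/-! ### The exact rate -/

theorem weighted_apply (d y : Fin S → ℝ) (k : Fin S) :
    weighted d y k = d k * (upperOnes S).mulVec y k := by
  rw [weighted, ← Matrix.mulVec_mulVec, Matrix.mulVec_diagonal]

/-- Column `k` of `D B* D⁻¹` sums to `(d B*)_k / d_k`. -/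
theorem sum_bStarStar {Q : Matrix (Fin (S + 1)) (Fin (S + 1)) ℝ} {d : Fin S → ℝ} {h : ℝ}
    (hd : ∀ k, 0 < d k) (heig : Matrix.vecMul d (bStar Q) = h • d) (k : Fin S) :
    ∑ i, bStarStar Q d i k = h := by
  have hk : ∑ i, d i * bStar Q i k = h * d k := congrFun heig k
  have hinv : (Matrix.diagonal d)⁻¹ = Matrix.diagonal fun k => (d k)⁻¹ := by
    refine Matrix.inv_eq_right_inv ?_
    rw [Matrix.diagonal_mul_diagonal, ← Matrix.diagonal_one]
    exact congrArg _ (funext fun k => mul_inv_cancel₀ (hd k).ne')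
  simp only [bStarStar, hinv, Matrix.mul_diagonal, Matrix.diagonal_mul]
  rw [← Finset.sum_mul, hk, mul_assoc, mul_inv_cancel₀ (hd k).ne', mul_one]

/-- The cumulative vector `T y` solves the system with matrix `B*`. -/
theorem IsReducedSolution.hasDerivWithinAt_cumulative
    {Q : Matrix (Fin (S + 1)) (Fin (S + 1)) ℝ} {y : ℝ → Fin S → ℝ}
    (hy : IsReducedSolution Q y) (t : ℝ) (ht : 0 ≤ t) :
    HasDerivWithinAt (fun t => (upperOnes S).mulVec (y t))
      ((bStar Q).mulVec ((upperOnes S).mulVec (y t))) (Ici 0) t := by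
  have h := (LinearMap.toContinuousLinearMap (upperOnes S).mulVecLin).hasFDerivAt
    |>.comp_hasDerivWithinAt t (hy t ht)
  refine h.congr_deriv ?_
  rw [Matrix.mulVec_mulVec, bStar_mul_upperOnes, ← Matrix.mulVec_mulVec]
  rfl

/-- A positive left eigenvector of an off-diagonally nonnegative `B*` gives the exact rate. -/
theorem l1Norm_weighted_eq {Q : Matrix (Fin (S + 1)) (Fin (S + 1)) ℝ} {d : Fin S → ℝ} {h : ℝ}
    (hM : ∀ i j, i ≠ j → 0 ≤ bStar Q i j) (hd : ∀ k, 0 < d k)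
    (heig : Matrix.vecMul d (bStar Q) = h • d) {y : ℝ → Fin S → ℝ}
    (hy : IsReducedSolution Q y) (h0 : ∀ k, 0 ≤ weighted d (y 0) k) {t : ℝ} (ht : 0 ≤ t) :
    l1Norm (weighted d (y t)) = Real.exp (h * t) * l1Norm (weighted d (y 0)) := by
  set z : ℝ → Fin S → ℝ := fun t => (upperOnes S).mulVec (y t) with hzdef
  have hz := hy.hasDerivWithinAt_cumulative
  have hz0 : 0 ≤ z 0 := fun k =>
    nonneg_of_mul_nonneg_right (weighted_apply d (y 0) k ▸ h0 k) (hd k)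
  have hnorm : ∀ s, 0 ≤ s → l1Norm (weighted d (y s)) = d ⬝ᵥ z s := fun s hs =>
    Finset.sum_congr rfl fun k _ => by
      rw [weighted_apply, abs_of_nonneg (mul_nonneg (hd k).le (nonneg_of_metzler hM hz hz0 hs k))]
  rw [hnorm t ht, hnorm 0 le_rfl]
  refine eq_exp_mul_of_hasDerivWithinAt (f := fun s => d ⬝ᵥ z s) (fun s hs => ?_) ht
  have hsum : HasDerivWithinAt (fun s => d ⬝ᵥ z s) (d ⬝ᵥ (bStar Q).mulVec (z s)) (Ici 0) s :=
    HasDerivWithinAt.fun_sum fun k _ => ((hasDerivWithinAt_pi.1 (hz s hs)) k).const_mul (d k)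
  rwa [Matrix.dotProduct_mulVec, heig, smul_dotProduct, smul_eq_mul] at hsum

theorem exists_rate [NeZero S] {Q : Matrix (Fin (S + 1)) (Fin (S + 1)) ℝ}
    (hQ : IsIntensityMatrix Q) (hup : UpwardMonotone Q.transpose)
    (hdown : DownwardMonotone Q.transpose) :
    ∃ d : Fin S → ℝ, (∀ k, 0 < d k) ∧ hUpper Q d = hLower Q d ∧
      ∀ y : ℝ → Fin S → ℝ, IsReducedSolution Q y → (∀ k, 0 ≤ weighted d (y 0) k) →
        ∀ t : ℝ, 0 ≤ t → l1Norm (weighted d (y t)) =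
          Real.exp (hLower Q d * t) * l1Norm (weighted d (y 0)) := by
  have hM : ∀ i j, i ≠ j → 0 ≤ bStar Q i j := fun i j hij =>
    (lt_or_gt_of_ne hij).elim (fun h => (hdown.bStar_nonneg hQ h).1)
      fun h => (hup.bStar_nonneg h).1
  obtain ⟨h, d, hd, heig⟩ := exists_pos_left_eigenvector hM
    (fun i j hij => (hup.bStar_nonneg (Fin.lt_def.2 (by omega))).2 hij)
    (fun i j hij => (hdown.bStar_nonneg hQ (Fin.lt_def.2 (by omega))).2 hij)
  have hlow : hLower Q d = h := by
    simp only [hLower, sum_bStarStar hd heig, Finset.inf'_const]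
  have hupp : hUpper Q d = h := by
    simp only [hUpper, sum_bStarStar hd heig, Finset.sup'_const]
  refine ⟨d, hd, hupp.trans hlow.symm, fun y hy h0 t ht => ?_⟩
  rw [hlow]
  exact l1Norm_weighted_eq hM hd heig hy h0 ht

end MarkovRate

theorem theorem3 (S : ℕ) [NeZero S] (Q : Matrix (Fin (S + 1)) (Fin (S + 1)) ℝ)
    (hQ : MarkovRate.IsIntensityMatrix Q)
    (hclass :
      (∃ lam mu : ℕ → ℝ, MarkovRate.IsClassI Q.transpose lam mu ∧
        (∀ i < S, 0 < mu (i + 1)) ∧ (∀ i < S, 0 < lam i)) ∨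
      (∃ a mu : ℕ → ℝ, MarkovRate.IsClassII Q.transpose a mu ∧
        (∀ i < S, 0 < mu (i + 1)) ∧ (2 ≤ S → a 2 < a 1)) ∨
      (∃ lam b : ℕ → ℝ, MarkovRate.IsClassIII Q.transpose lam b ∧
        (∀ i < S, 0 < lam i) ∧ (2 ≤ S → b 2 < b 1)) ∨
      (∃ a b : ℕ → ℝ, MarkovRate.IsClassIV Q.transpose a b ∧
        (2 ≤ S → a 2 < a 1) ∧ (2 ≤ S → b 2 < b 1))) :
    ∃ d : Fin S → ℝ, (∀ k, 0 < d k) ∧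
      MarkovRate.hUpper Q d = MarkovRate.hLower Q d ∧
      ∀ y : ℝ → Fin S → ℝ, MarkovRate.IsReducedSolution Q y →
        (∀ k, 0 ≤ MarkovRate.weighted d (y 0) k) →
        ∀ t : ℝ, 0 ≤ t →
          MarkovRate.l1Norm (MarkovRate.weighted d (y t)) =
            Real.exp (MarkovRate.hLower Q d * t) *
              MarkovRate.l1Norm (MarkovRate.weighted d (y 0)) := by
  obtain ⟨hup, hdown⟩ : MarkovRate.UpwardMonotone Q.transpose ∧
      MarkovRate.DownwardMonotone Q.transpose := by
    rcases hclass with ⟨lam, mu, h, hmu, hlam⟩ | ⟨a, mu, h, hmu, ha⟩ | ⟨lam, b, h, hlam, hb⟩ |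
      ⟨a, b, h, ha, hb⟩
    · exact ⟨MarkovRate.upwardMonotone_of_single hQ
          (fun i j hij => h.zero i j (lt_abs.2 (Or.inl (by omega)))) h.birth hlam,
        MarkovRate.downwardMonotone_of_single hQ
          (fun i j hij => h.zero i j (lt_abs.2 (Or.inr (by omega)))) h.death hmu⟩
    · exact ⟨MarkovRate.upwardMonotone_of_batch h.birth h.mono ha,
        MarkovRate.downwardMonotone_of_single hQ h.zero h.death hmu⟩
    · exact ⟨MarkovRate.upwardMonotone_of_single hQ h.zero h.birth hlam,
        MarkovRate.downwardMonotone_of_batch h.death h.mono hb⟩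
    · exact ⟨MarkovRate.upwardMonotone_of_batch h.birth h.mono_birth ha,
        MarkovRate.downwardMonotone_of_batch h.death h.mono_death hb⟩
  exact MarkovRate.exists_rate hQ hup hdown
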